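/- Let $n,k\ge 0$ be integers and let $M\sim\mathrm{GUE}_n$, i.e. $M$ is a random $n\times n$ complex Hermitian matrix whose diagonal entries are normal with mean $0$ and variance $1$, whose entries above the diagonal have real and imaginary parts normal with mean $0$ and variance $\frac12$, and all these $n^2$ real random variables are independent. Then $\det(M^k)$ is integrable, and $$\mathbb{E}\big[\det (M^k)\big]=\begin{cases}\displaystyle\prod_{i=1}^{n}\prod_{j=1}^{k/2}\Big(2\Big\lfloor\frac i2\Big\rfloor+2j-1\Big)&\text{if $k$ is even},\\[2ex]\displaystyle(-1)^{nk/2}\prod_{i=1}^{k}\prod_{j=1}^{n/2}\Big(2\Big\lfloor\frac i2\Big\rfloor+2j-1\Big)&\text{if $n$ is even},\\[2ex]0&\text{if $n$ and $k$ are both odd.}\end{cases}$$ When $n$ and $k$ are both even, both formulas hold. -/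

import Mathlib

open MeasureTheory ProbabilityTheory

/-- Complex matrices carry the product σ-algebra of their entries. -/
noncomputable instance matrixMeasurableSpace (n : ℕ) : MeasurableSpace (Matrix (Fin n) (Fin n) ℂ) :=
  MeasurableSpace.pi (X := fun _ : Fin n => Fin n → ℂ)

/-- The Hermitian `n × n` matrix with coordinates `x`: the diagonal entries are the reals `x i i`,
and the entry in a position `i < j` above the diagonal is `x i j + x j i * I`. -/
def hermitianOfCoords {n : ℕ} (x : Fin n → Fin n → ℝ) : Matrix (Fin n) (Fin n) ℂ :=
  Matrix.of fun i j =>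
    if i = j then (x i i : ℂ)
    else if i < j then (x i j : ℂ) + (x j i : ℂ) * Complex.I
    else (x j i : ℂ) - (x i j : ℂ) * Complex.I

theorem hermitianOfCoords_isHermitian {n : ℕ} (x : Fin n → Fin n → ℝ) :
    (hermitianOfCoords x).IsHermitian := by
  ext i j
  rcases lt_trichotomy i j with h | h | h
  · simp [hermitianOfCoords, h, h.ne, h.ne', h.not_gt, sub_eq_add_neg]
  · subst h
    simp [hermitianOfCoords]
  · simp [hermitianOfCoords, h, h.ne, h.ne', h.not_gt, sub_eq_add_neg]

theorem measurable_hermitianOfCoords {n : ℕ} :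
    Measurable (hermitianOfCoords : (Fin n → Fin n → ℝ) → Matrix (Fin n) (Fin n) ℂ) := by
  refine measurable_pi_lambda _ fun i => measurable_pi_lambda _ fun j => ?_
  simp only [hermitianOfCoords, Matrix.of_apply]
  split_ifs <;> fun_prop

/-- The Gaussian unitary ensemble of order `n`, as a probability measure on complex matrices: the
law of a Hermitian matrix whose diagonal entries are standard normal and whose entries above the
diagonal have real and imaginary parts normal with mean `0` and variance `1 / 2`, all of these
`n ^ 2` real random variables being independent. -/
noncomputable def gue (n : ℕ) : Measure (Matrix (Fin n) (Fin n) ℂ) :=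
  (Measure.pi fun i : Fin n => Measure.pi fun j : Fin n =>
    gaussianReal 0 (if i = j then 1 else 1 / 2)).map hermitianOfCoords

instance gue_isProbabilityMeasure (n : ℕ) : IsProbabilityMeasure (gue n) :=
  Measure.isProbabilityMeasure_map measurable_hermitianOfCoords.aemeasurable

-- Write (x)_s for the rising factorial. The determinant's moments do not close up under a recursion
-- in the order, but joint moments do: let F(n,p,q) be the expectation of det(A)^p det(A')^q, where
-- A is GUE of order n and A' is its lower right principal minor of order n-1.
--
-- Split a matrix of order n+2 into a corner a, a row v (with its conjugate column) and a block B of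
-- order n+1. These are independent, and B is invariant under unitary conjugation
-- (`measurePreserving_gue_conj`), so for fixed v one may rotate v to (t,0,...,0) with t^2 = |v|^2.
-- The determinant then becomes a det B - t^2 det B'. Expanding the p-th power and integrating, with
-- a standard normal and |v|^2 having moments (n+1)_s, gives `minorMoment_add_two`, which expresses
-- F(n+2,p,q) through F(n+1,q+p-s,s).
--
-- The total degree p+q is preserved by this recursion. For fixed total degree the moments factor
-- explicitly (`OddMinorFormula`, `EvenMinorFormula`), and the induction step is a Chu–Vandermonde
-- summation (`sum_risingFactorial_eq_of_mul_eq`). Taking q = 0 and comparing consecutive orders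
-- turns the closed forms into the stated products.

-- Rising factorials and the Chu–Vandermonde summation.

section RisingFactorial

variable {K : Type*} [Field K]

/-- The rising factorial `x (x + 1) ⋯ (x + n - 1)`. -/
def risingFactorial (x : K) (n : ℕ) : K := ∏ i ∈ Finset.range n, (x + i)

@[simp] theorem risingFactorial_zero (x : K) : risingFactorial x 0 = 1 := by
  simp [risingFactorial]

theorem risingFactorial_succ (x : K) (n : ℕ) :
    risingFactorial x (n + 1) = risingFactorial x n * (x + n) := by
  simp [risingFactorial, Finset.prod_range_succ]

theorem risingFactorial_succ' (x : K) (n : ℕ) :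
    risingFactorial x (n + 1) = x * risingFactorial (x + 1) n := by
  simp only [risingFactorial, Finset.prod_range_succ']
  rw [mul_comm]
  congr 1
  · simp
  · exact Finset.prod_congr rfl fun i _ => by push_cast; ring

theorem risingFactorial_add (x : K) (m n : ℕ) :
    risingFactorial x (m + n) = risingFactorial x m * risingFactorial (x + m) n := by
  simp only [risingFactorial, Finset.prod_range_add]
  congr 1
  exact Finset.prod_congr rfl fun i _ => by push_cast; ring

/-- Both sides are (x)_{m+n}, split at m or at n. -/
theorem risingFactorial_mul_swap (x : K) (m n : ℕ) :
    risingFactorial x m * risingFactorial (m + x) n =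
      risingFactorial x n * risingFactorial (n + x) m := by
  rw [add_comm (m : K), add_comm (n : K), ← risingFactorial_add, ← risingFactorial_add, add_comm]

/-- The Chu–Vandermonde identity for rising factorials. -/
theorem sum_choose_mul_risingFactorial (a : ℕ) (x y : K) :
    ∑ s ∈ Finset.range (a + 1), (a.choose s : K) * risingFactorial x s *
      risingFactorial y (a - s) = risingFactorial (x + y) a := by
  induction a generalizing x y with
  | zero => simp
  | succ a ih =>
    have h1 : ∑ s ∈ Finset.range (a + 1), (a.choose s : K) * risingFactorial x (s + 1) *
        risingFactorial y (a - s) = x * risingFactorial (x + 1 + y) a := by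
      rw [← ih, Finset.mul_sum]
      refine Finset.sum_congr rfl fun s _ => ?_
      rw [risingFactorial_succ']; ring
    have h2 : ∑ s ∈ Finset.range (a + 1), (a.choose s : K) * risingFactorial x s *
        risingFactorial y (a - s + 1) = y * risingFactorial (x + (y + 1)) a := by
      rw [← ih, Finset.mul_sum]
      refine Finset.sum_congr rfl fun s _ => ?_
      rw [risingFactorial_succ' y]; ring
    -- Pascal's rule splits the sum in two; each half is the induction hypothesis with one argument
    -- raised by 1.
    have h3 : ∑ s ∈ Finset.range (a + 1 + 1), ((a + 1).choose s : K) * risingFactorial x s *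
        risingFactorial y (a + 1 - s) =
        (∑ s ∈ Finset.range (a + 1), (a.choose s : K) * risingFactorial x (s + 1) *
          risingFactorial y (a - s)) +
        ∑ s ∈ Finset.range (a + 1), (a.choose s : K) * risingFactorial x s *
          risingFactorial y (a - s + 1) := by
      rw [Finset.sum_range_succ']
      simp only [Nat.choose_succ_succ, Nat.cast_add, add_mul, Finset.sum_add_distrib,
        Nat.add_sub_add_right]
      rw [add_assoc]
      congr 1
      have : ∀ s ∈ Finset.range (a + 1), (a.choose s : K) * risingFactorial x s *
          risingFactorial y (a - s + 1) = (a.choose s : K) * risingFactorial x s *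
          risingFactorial y (a + 1 - s) := fun s hs => by
        rw [Nat.sub_add_comm (Nat.lt_succ_iff.1 (Finset.mem_range.1 hs))]
      have h4 := (Finset.sum_range_succ' (fun s => (a.choose s : K) * risingFactorial x s *
        risingFactorial y (a + 1 - s)) (a + 1)).symm.trans (Finset.sum_range_succ _ (a + 1))
      simp only [Nat.choose_succ_self, Nat.cast_zero, zero_mul, add_zero,
        Nat.add_sub_add_right] at h4
      rw [Finset.sum_congr rfl this, ← h4]
      simp
    rw [h3, h1, h2, risingFactorial_succ', show x + 1 + y = x + y + 1 by ring,
      show x + (y + 1) = x + y + 1 by ring]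
    ring

theorem risingFactorial_two_mul [CharZero K] (x : K) (n : ℕ) :
    risingFactorial (2 * x) (2 * n) =
      4 ^ n * risingFactorial x n * risingFactorial (x + 1 / 2) n := by
  induction n with
  | zero => simp
  | succ n ih =>
    rw [show 2 * (n + 1) = 2 * n + 1 + 1 by ring]
    simp only [risingFactorial_succ, ih]
    push_cast
    field_simp
    ring

theorem risingFactorial_half_add_one [CharZero K] (N : ℕ) :
    risingFactorial (1 / 2 + 1 : K) N = risingFactorial (1 / 2) N * (2 * N + 1) := by
  have h := risingFactorial_succ' (1 / 2 : K) N
  rw [risingFactorial_succ] at h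
  linear_combination (-2) * h

theorem factorial_two_mul_eq_risingFactorial [CharZero K] (n : ℕ) :
    ((2 * n).factorial : K) = 4 ^ n * n.factorial * risingFactorial (1 / 2) n := by
  induction n with
  | zero => simp
  | succ n ih =>
    rw [show 2 * (n + 1) = 2 * n + 1 + 1 by ring, Nat.factorial_succ, Nat.factorial_succ,
      Nat.factorial_succ, risingFactorial_succ]
    push_cast
    rw [ih]
    field_simp
    ring

theorem factorial_two_mul_add_one_eq_risingFactorial [CharZero K] (n : ℕ) :
    ((2 * n + 1).factorial : K) = 4 ^ n * n.factorial * risingFactorial (1 / 2 + 1) n := by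
  rw [Nat.factorial_succ]
  push_cast
  rw [factorial_two_mul_eq_risingFactorial, risingFactorial_half_add_one]
  ring

theorem risingFactorial_half_ne_zero [CharZero K] (m n : ℕ) :
    risingFactorial (m + 1 / 2 : K) n ≠ 0 := by
  refine Finset.prod_ne_zero_iff.2 fun i _ h => ?_
  have h' : ((2 * m + 1 + 2 * i : ℕ) : K) = 0 := by
    push_cast
    linear_combination 2 * h
  exact absurd (Nat.cast_eq_zero.1 h') (by omega)

theorem risingFactorial_half_ne_zero' [CharZero K] (N : ℕ) : risingFactorial (1 / 2 : K) N ≠ 0 := by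
  simpa using risingFactorial_half_ne_zero (K := K) 0 N

/-- Since (2n)! = 4^n n! (1/2)_n, a binomial coefficient with even entries reduces to one with
halved entries. This lemma and its odd analogue supply the hypothesis `hb` of
`sum_risingFactorial_eq_of_mul_eq`. -/
theorem choose_two_mul_mul_risingFactorial [CharZero K] {a s : ℕ} (h : s ≤ a) :
    ((2 * a).choose (2 * s) : K) * risingFactorial (1 / 2) (a - s) * risingFactorial (1 / 2) s =
      a.choose s * risingFactorial (1 / 2) a := by
  have h1 : ((2 * a).choose (2 * s) : K) * (2 * s).factorial * (2 * (a - s)).factorial =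
      (2 * a).factorial := by
    rw [show 2 * (a - s) = 2 * a - 2 * s by omega]
    exact_mod_cast Nat.choose_mul_factorial_mul_factorial (by omega : 2 * s ≤ 2 * a)
  have h2 : (a.choose s : K) * s.factorial * (a - s).factorial = a.factorial := by
    exact_mod_cast Nat.choose_mul_factorial_mul_factorial h
  simp only [factorial_two_mul_eq_risingFactorial] at h1
  have h4 : (4 : K) ^ s * 4 ^ (a - s) = 4 ^ a := by rw [← pow_add]; congr 1; omega
  have h5 : (4 : K) ^ a * s.factorial * (a - s).factorial ≠ 0 := by
    simp [Nat.factorial_ne_zero]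
  refine mul_left_cancel₀ h5 ?_
  rw [← h2, ← h4] at h1
  rw [← h4]
  linear_combination h1

theorem choose_two_mul_add_one_mul_risingFactorial [CharZero K] {a s : ℕ} (h : s ≤ a) :
    ((2 * a + 1).choose (2 * s + 1) : K) * risingFactorial (1 / 2) (a - s) *
      risingFactorial (1 / 2 + 1) s = a.choose s * risingFactorial (1 / 2 + 1) a := by
  have h1 : ((2 * a + 1).choose (2 * s + 1) : K) * (2 * s + 1).factorial *
      (2 * (a - s)).factorial = (2 * a + 1).factorial := by
    rw [show 2 * (a - s) = 2 * a + 1 - (2 * s + 1) by omega]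
    exact_mod_cast Nat.choose_mul_factorial_mul_factorial (by omega : 2 * s + 1 ≤ 2 * a + 1)
  have h2 : (a.choose s : K) * s.factorial * (a - s).factorial = a.factorial := by
    exact_mod_cast Nat.choose_mul_factorial_mul_factorial h
  simp only [factorial_two_mul_eq_risingFactorial,
    factorial_two_mul_add_one_eq_risingFactorial] at h1
  have h4 : (4 : K) ^ s * 4 ^ (a - s) = 4 ^ a := by rw [← pow_add]; congr 1; omega
  have h5 : (4 : K) ^ a * s.factorial * (a - s).factorial ≠ 0 := by
    simp [Nat.factorial_ne_zero]
  refine mul_left_cancel₀ h5 ?_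
  rw [← h2, ← h4] at h1
  rw [← h4]
  linear_combination h1

/-- Common form of the three summations that solve the recursion; `g` stands for the moments of the
previous order. The swap identity trades (N+h)_s for the (s+h)_N that `hg` asks for, `hb` absorbs
the (h)_s left over, and what remains is the Chu–Vandermonde sum of (X)_s (x+d)_{a-s}. -/
theorem sum_risingFactorial_eq_of_mul_eq {a d N X : ℕ} {x h C : K} {b g : ℕ → K}
    (hb : ∀ s ≤ a, b s * risingFactorial h s = a.choose s * risingFactorial h a)
    (hg : ∀ s ≤ a, g s * risingFactorial (s + h) N =
      2 ^ (a + d - s) * risingFactorial x (a + d - s) * C) :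
    (∑ s ∈ Finset.range (a + 1), b s * 2 ^ (a - s) * (4 ^ s * risingFactorial (X : K) s *
      risingFactorial (N + h) s) * g s) * risingFactorial h N * risingFactorial (x + d) X =
      2 ^ (a + (a + d)) * risingFactorial h a * C * risingFactorial x (a + d + X) := by
  have h1 : (∑ s ∈ Finset.range (a + 1), b s * 2 ^ (a - s) * (4 ^ s * risingFactorial (X : K) s *
      risingFactorial (N + h) s) * g s) * risingFactorial h N =
      2 ^ (a + (a + d)) * risingFactorial h a * C * risingFactorial x d *
        risingFactorial (X + (x + d)) a := by
    rw [← sum_choose_mul_risingFactorial, Finset.mul_sum, Finset.sum_mul]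
    refine Finset.sum_congr rfl fun s hs => ?_
    have hs : s ≤ a := Nat.lt_succ_iff.1 (Finset.mem_range.1 hs)
    have e1 : risingFactorial x (a + d - s) =
        risingFactorial x d * risingFactorial (x + d) (a - s) := by
      rw [← risingFactorial_add]; congr 1; omega
    have e2 : (2 : K) ^ (a + (a + d)) = 2 ^ (a - s) * 4 ^ s * 2 ^ (a + d - s) := by
      rw [show (4 : K) = 2 ^ 2 by norm_num, ← pow_mul, ← pow_add, ← pow_add]
      congr 1; omega
    have e3 := risingFactorial_mul_swap h N s
    have e4 := hb s hs
    have e5 := hg s hs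
    rw [e1] at e5
    rw [e2]
    calc _ = b s * 2 ^ (a - s) * 4 ^ s * risingFactorial (X : K) s * g s *
          (risingFactorial h N * risingFactorial (N + h) s) := by ring
      _ = (b s * risingFactorial h s) * 2 ^ (a - s) * 4 ^ s * risingFactorial (X : K) s *
          (g s * risingFactorial (s + h) N) := by rw [e3]; ring
      _ = _ := by rw [e4, e5]; ring
  rw [h1, show a + d + X = d + (X + a) by ring, risingFactorial_add x d, risingFactorial_add _ X,
    show (X : K) + (x + d) = x + d + X by ring]
  ring

end RisingFactorial

theorem sum_range_two_mul_add_one_of_odd_eq_zero {K : Type*} [AddCommMonoid K] {f : ℕ → K}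
    (hf : ∀ s, f (2 * s + 1) = 0) (a : ℕ) :
    ∑ s ∈ Finset.range (2 * a + 1), f s = ∑ s ∈ Finset.range (a + 1), f (2 * s) := by
  induction a with
  | zero => simp
  | succ a ih =>
    rw [Finset.sum_range_succ _ (a + 1), ← ih, show 2 * (a + 1) + 1 = 2 * a + 1 + 1 + 1 by ring,
      Finset.sum_range_succ, Finset.sum_range_succ, hf, add_zero]
    rfl

theorem sum_range_two_mul_add_two_of_even_eq_zero {K : Type*} [AddCommMonoid K] {f : ℕ → K}
    (hf : ∀ s, f (2 * s) = 0) (a : ℕ) :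
    ∑ s ∈ Finset.range (2 * a + 1 + 1), f s = ∑ s ∈ Finset.range (a + 1), f (2 * s + 1) := by
  induction a with
  | zero => simp [Finset.sum_range_succ, show f 0 = 0 from hf 0]
  | succ a ih =>
    rw [Finset.sum_range_succ _ (a + 1), ← ih,
      show 2 * (a + 1) + 1 + 1 = 2 * a + 1 + 1 + 1 + 1 by ring,
      Finset.sum_range_succ, Finset.sum_range_succ _ (2 * a + 1 + 1),
      show f (2 * a + 1 + 1) = 0 from hf (a + 1), add_zero]
    rfl

-- Closed form of the joint moments.

section MomentRecursion

variable {K : Type*} [Field K]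

/-- The `r`-th moment of a standard normal variable. -/
def gaussianMoment (K : Type*) [Field K] (r : ℕ) : K :=
  if Even r then 2 ^ (r / 2) * risingFactorial (1 / 2) (r / 2) else 0

theorem gaussianMoment_two_mul (a : ℕ) :
    gaussianMoment K (2 * a) = 2 ^ a * risingFactorial (1 / 2) a := by
  simp [gaussianMoment]

theorem gaussianMoment_of_odd {r : ℕ} (h : Odd r) : gaussianMoment K r = 0 := by
  simp [gaussianMoment, Nat.not_even_iff_odd.2 h]

/-- The double factorial of the odd one of `p` and `p - 1`. -/
def oddDoubleFactorial (K : Type*) [Field K] (p : ℕ) : K :=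
  2 ^ (p / 2) * risingFactorial (1 / 2 + ((p % 2 : ℕ) : K)) (p / 2)

theorem oddDoubleFactorial_two_mul (a : ℕ) :
    oddDoubleFactorial K (2 * a) = 2 ^ a * risingFactorial (1 / 2) a := by
  simp [oddDoubleFactorial]

theorem oddDoubleFactorial_two_mul_add_one (a : ℕ) :
    oddDoubleFactorial K (2 * a + 1) = 2 ^ a * risingFactorial (1 / 2 + 1) a := by
  have h1 : (2 * a + 1) / 2 = a := by omega
  have h2 : (2 * a + 1) % 2 = 1 := by omega
  simp [oddDoubleFactorial, h1, h2]

theorem oddDoubleFactorial_ne_zero [CharZero K] (p : ℕ) : oddDoubleFactorial K p ≠ 0 := by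
  have h := risingFactorial_half_ne_zero (K := K) (p % 2) (p / 2)
  rw [add_comm] at h
  exact mul_ne_zero (pow_ne_zero _ two_ne_zero) h

/-- The recursion satisfied by the joint moments `F n p q` of the determinants of a `GUE` matrix of
order `n` and of its principal minor of order `n - 1`. -/
structure IsMinorMoment (F : ℕ → ℕ → ℕ → K) : Prop where
  one : ∀ p q, F 1 p q = gaussianMoment K p
  add_two : ∀ n p q, F (n + 2) p q = ∑ s ∈ Finset.range (p + 1), (p.choose s : K) *
    gaussianMoment K (p - s) * (-1) ^ s * risingFactorial ((n + 1 : ℕ) : K) s *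
      F (n + 1) (q + (p - s)) s

mutual
/-- The factor of the joint moments in even order `2 * N` that depends on the total degree. -/
def evenMinorConst (K : Type*) [Field K] : ℕ → ℕ → K
  | 0, k => (oddDoubleFactorial K k)⁻¹
  | N + 1, k => (-1) ^ k * 2 ^ (k / 2) * risingFactorial (1 / 2) (k / 2 + N + 1) /
      risingFactorial (1 / 2) N * oddMinorConst K N k
/-- The factor of the joint moments in odd order `2 * N + 1` that depends on the total degree. -/
def oddMinorConst (K : Type*) [Field K] : ℕ → ℕ → K
  | N, k => 2 ^ (k / 2) * risingFactorial (1 / 2 + ((k % 2 : ℕ) : K)) (k / 2 + N) /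
      risingFactorial (1 / 2) N * evenMinorConst K N k
end

variable [CharZero K] {F : ℕ → ℕ → ℕ → K}

/-- The initial value of `evenMinorConst` makes the order 0 moment equal to 1, and here it cancels
the degree factor exactly. -/
theorem oddMinorConst_zero (k : ℕ) : oddMinorConst K 0 k = 1 := by
  rw [oddMinorConst, evenMinorConst]
  have := oddDoubleFactorial_ne_zero (K := K) k
  rw [oddDoubleFactorial] at *
  simpa using mul_inv_cancel₀ this

/-- The closed form of the joint moments in order `2 * N + 1`; the total degree is `2 * a + q`. -/
def OddMinorFormula (F : ℕ → ℕ → ℕ → K) (N : ℕ) : Prop :=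
  (∀ p q, Odd p → F (2 * N + 1) p q = 0) ∧
  ∀ a q, F (2 * N + 1) (2 * a) q * risingFactorial (((q + 1) / 2 : ℕ) + 1 / 2 : K) N =
    2 ^ a * risingFactorial (1 / 2) a * oddMinorConst K N (2 * a + q)

/-- The closed form of the joint moments in order `2 * N`; the total degree is `p + 2 * d`. -/
def EvenMinorFormula (F : ℕ → ℕ → ℕ → K) (N : ℕ) : Prop :=
  (∀ p q, Odd q → F (2 * N) p q = 0) ∧
  ∀ p d, F (2 * N) p (2 * d) * risingFactorial (d + 1 / 2 : K) N =
    oddDoubleFactorial K p * evenMinorConst K N (p + 2 * d)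

theorem IsMinorMoment.oddMinorFormula_zero (hF : IsMinorMoment F) : OddMinorFormula F 0 := by
  refine ⟨fun p q hp => ?_, fun a q => ?_⟩
  · rw [mul_zero, zero_add, hF.one, gaussianMoment_of_odd hp]
  · rw [mul_zero, zero_add, hF.one, gaussianMoment_two_mul, oddMinorConst_zero]
    simp

/-- Odd s contributes nothing because the even-order moment vanishes. If p is odd, even s is killed
by the odd Gaussian moment; if p is even, duplication of (2N+2)_{2s} brings the sum to
Chu–Vandermonde form. -/
theorem IsMinorMoment.oddMinorFormula_of_even (hF : IsMinorMoment F) {N : ℕ}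
    (h : EvenMinorFormula F (N + 1)) : OddMinorFormula F (N + 1) := by
  have hrec : ∀ p q, F (2 * (N + 1) + 1) p q = ∑ s ∈ Finset.range (p + 1), (p.choose s : K) *
      gaussianMoment K (p - s) * (-1) ^ s * risingFactorial ((2 * (N + 1) : ℕ) : K) s *
      F (2 * (N + 1)) (q + (p - s)) s := fun p q => hF.add_two (2 * N + 1) p q
  refine ⟨fun p q hp => ?_, fun a q => ?_⟩
  · rw [hrec]
    refine Finset.sum_eq_zero fun s hs => ?_
    have hs : s ≤ p := Nat.lt_succ_iff.1 (Finset.mem_range.1 hs)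
    rcases Nat.even_or_odd s with he | ho
    · rw [gaussianMoment_of_odd (Nat.Odd.sub_even hs hp he)]; ring
    · rw [h.1 _ _ ho]; ring
  · rw [hrec, sum_range_two_mul_add_one_of_odd_eq_zero
      (fun s => by rw [h.1 _ _ ⟨s, rfl⟩, mul_zero])]
    -- The parity e of q only shifts the base to x = 1/2 + e, so both parities share one summation.
    obtain ⟨d, e, he, rfl⟩ : ∃ d e, e < 2 ∧ q = 2 * d + e :=
      ⟨q / 2, q % 2, Nat.mod_lt _ two_pos, by omega⟩
    have key := sum_risingFactorial_eq_of_mul_eq (K := K) (a := a) (d := d) (N := N + 1)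
      (X := N + 1) (x := 1 / 2 + (e : ℕ)) (h := 1 / 2)
      (C := evenMinorConst K (N + 1) (2 * a + (2 * d + e)))
      (b := fun s => ((2 * a).choose (2 * s) : K) * risingFactorial (1 / 2) (a - s))
      (g := fun s => F (2 * (N + 1)) (2 * d + e + (2 * a - 2 * s)) (2 * s))
      (fun s hs => choose_two_mul_mul_risingFactorial hs) (fun s hs => by
        have := h.2 (2 * d + e + (2 * a - 2 * s)) s
        rw [this, oddDoubleFactorial]
        have h1 : (2 * d + e + (2 * a - 2 * s)) / 2 = a + d - s := by omega
        have h2 : (2 * d + e + (2 * a - 2 * s)) % 2 = e := by omega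
        have h3 : 2 * d + e + (2 * a - 2 * s) + 2 * s = 2 * a + (2 * d + e) := by omega
        rw [h1, h2, h3])
    have hsum : ∑ s ∈ Finset.range (a + 1), ((2 * a).choose (2 * s) : K) *
        gaussianMoment K (2 * a - 2 * s) * (-1) ^ (2 * s) *
        risingFactorial ((2 * (N + 1) : ℕ) : K) (2 * s) *
        F (2 * (N + 1)) (2 * d + e + (2 * a - 2 * s)) (2 * s) =
        ∑ s ∈ Finset.range (a + 1), ((2 * a).choose (2 * s) : K) *
        risingFactorial (1 / 2) (a - s) * 2 ^ (a - s) *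
        (4 ^ s * risingFactorial ((N + 1 : ℕ) : K) s *
          risingFactorial ((N + 1 : ℕ) + 1 / 2 : K) s) *
        F (2 * (N + 1)) (2 * d + e + (2 * a - 2 * s)) (2 * s) := by
      refine Finset.sum_congr rfl fun s hs => ?_
      rw [← Nat.mul_sub, gaussianMoment_two_mul, pow_mul, neg_one_sq, one_pow, Nat.cast_mul,
        Nat.cast_ofNat, risingFactorial_two_mul]
      ring
    rw [hsum]
    have h0 := risingFactorial_half_ne_zero' (K := K) (N + 1)
    rw [oddMinorConst]
    have h1 : (2 * a + (2 * d + e)) / 2 = a + d := by omega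
    have h2 : (2 * a + (2 * d + e)) % 2 = e := by omega
    have h3 : (((2 * d + e + 1) / 2 : ℕ) : K) + 1 / 2 = 1 / 2 + (e : ℕ) + d := by
      have : (2 * d + e + 1) / 2 = d + e := by omega
      rw [this]; push_cast; ring
    rw [h1, h2, h3]
    refine mul_right_cancel₀ h0 ?_
    calc _ = _ := mul_right_comm _ _ _
      _ = _ := key
      _ = _ := by
        field_simp
        ring

/-- Only s of the same parity as p survives, as otherwise the Gaussian moment is odd. For such s the
previous moment has first degree of the parity of q, hence vanishes for odd q. The parity of p
decides between h = 1/2 and h = 3/2. -/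
theorem IsMinorMoment.evenMinorFormula_of_odd (hF : IsMinorMoment F) {N : ℕ}
    (h : OddMinorFormula F N) : EvenMinorFormula F (N + 1) := by
  have hrec : ∀ p q, F (2 * (N + 1)) p q = ∑ s ∈ Finset.range (p + 1), (p.choose s : K) *
      gaussianMoment K (p - s) * (-1) ^ s * risingFactorial ((2 * N + 1 : ℕ) : K) s *
      F (2 * N + 1) (q + (p - s)) s := fun p q => hF.add_two (2 * N) p q
  have h0 := risingFactorial_half_ne_zero' (K := K) N
  refine ⟨fun p q hq => ?_, fun p d => ?_⟩
  · rw [hrec]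
    refine Finset.sum_eq_zero fun s hs => ?_
    rcases Nat.even_or_odd (p - s) with he | ho
    · rw [h.1 _ _ (hq.add_even he)]; ring
    · rw [gaussianMoment_of_odd ho]; ring
  rcases Nat.even_or_odd' p with ⟨a, rfl | rfl⟩
  · rw [hrec, sum_range_two_mul_add_one_of_odd_eq_zero (fun s => by
      -- Past the end of the range truncated subtraction gives the zeroth Gaussian moment, which is
      -- 1; there the binomial coefficient must vanish instead.
      rcases Nat.lt_or_ge (2 * a) (2 * s + 1) with h1 | h1
      · rw [Nat.choose_eq_zero_of_lt h1]; simp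
      · rw [gaussianMoment_of_odd ⟨a - s - 1, by omega⟩]; ring)]
    have key := sum_risingFactorial_eq_of_mul_eq (K := K) (a := a) (d := d) (N := N)
      (X := N + 1) (x := 1 / 2) (h := 1 / 2)
      (C := oddMinorConst K N (2 * a + 2 * d))
      (b := fun s => ((2 * a).choose (2 * s) : K) * risingFactorial (1 / 2) (a - s))
      (g := fun s => F (2 * N + 1) (2 * d + (2 * a - 2 * s)) (2 * s))
      (fun s hs => choose_two_mul_mul_risingFactorial hs) (fun s hs => by
        have := h.2 (a + d - s) (2 * s)
        rw [show (2 * s + 1) / 2 = s by omega,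
          show 2 * (a + d - s) + 2 * s = 2 * a + 2 * d by omega] at this
        rw [← this]
        congr 2
        omega)
    have hsum : ∑ s ∈ Finset.range (a + 1), ((2 * a).choose (2 * s) : K) *
        gaussianMoment K (2 * a - 2 * s) * (-1) ^ (2 * s) *
        risingFactorial ((2 * N + 1 : ℕ) : K) (2 * s) *
        F (2 * N + 1) (2 * d + (2 * a - 2 * s)) (2 * s) =
        ∑ s ∈ Finset.range (a + 1), ((2 * a).choose (2 * s) : K) *
        risingFactorial (1 / 2) (a - s) * 2 ^ (a - s) *
        (4 ^ s * risingFactorial ((N + 1 : ℕ) : K) s *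
          risingFactorial (N + 1 / 2 : K) s) *
        F (2 * N + 1) (2 * d + (2 * a - 2 * s)) (2 * s) := by
      refine Finset.sum_congr rfl fun s hs => ?_
      have e1 : ((2 * N + 1 : ℕ) : K) = 2 * (N + 1 / 2) := by push_cast; ring
      have e2 : (N + 1 / 2 + 1 / 2 : K) = (N + 1 : ℕ) := by push_cast; ring
      rw [← Nat.mul_sub, gaussianMoment_two_mul, pow_mul, neg_one_sq, one_pow, e1,
        risingFactorial_two_mul, e2]
      ring
    rw [hsum, evenMinorConst, oddDoubleFactorial_two_mul]
    have h1 : (2 * a + 2 * d) / 2 = a + d := by omega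
    have h2 : ((-1 : K)) ^ (2 * a + 2 * d) = 1 := Even.neg_one_pow ⟨a + d, by ring⟩
    rw [h1, h2, add_comm (d : K)]
    refine mul_right_cancel₀ h0 ?_
    calc _ = _ := mul_right_comm _ _ _
      _ = _ := key
      _ = _ := by
        field_simp
        ring_nf
  · rw [hrec, sum_range_two_mul_add_two_of_even_eq_zero (fun s => by
      rcases Nat.lt_or_ge (2 * a + 1) (2 * s) with h1 | h1
      · rw [Nat.choose_eq_zero_of_lt h1]; simp
      · rw [gaussianMoment_of_odd ⟨a - s, by omega⟩]; ring)]
    have key := sum_risingFactorial_eq_of_mul_eq (K := K) (a := a) (d := d) (N := N)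
      (X := N + 1) (x := 1 / 2) (h := 1 / 2 + 1)
      (C := oddMinorConst K N (2 * a + 1 + 2 * d))
      (b := fun s => ((2 * a + 1).choose (2 * s + 1) : K) * risingFactorial (1 / 2) (a - s))
      (g := fun s => F (2 * N + 1) (2 * d + (2 * a + 1 - (2 * s + 1))) (2 * s + 1))
      (fun s hs => choose_two_mul_add_one_mul_risingFactorial hs) (fun s hs => by
        have := h.2 (a + d - s) (2 * s + 1)
        rw [show (2 * s + 1 + 1) / 2 = s + 1 by omega,
          show 2 * (a + d - s) + (2 * s + 1) = 2 * a + 1 + 2 * d by omega] at this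
        rw [← this]
        congr 2
        · omega
        · push_cast; ring)
    have hsum : ∑ s ∈ Finset.range (a + 1), ((2 * a + 1).choose (2 * s + 1) : K) *
        gaussianMoment K (2 * a + 1 - (2 * s + 1)) * (-1) ^ (2 * s + 1) *
        risingFactorial ((2 * N + 1 : ℕ) : K) (2 * s + 1) *
        F (2 * N + 1) (2 * d + (2 * a + 1 - (2 * s + 1))) (2 * s + 1) =
        -- Duplication needs an even length, so the first factor 2N+1 of (2N+1)_{2s+1} is split off;
        -- it cancels later against (3/2)_N = (1/2)_N (2N+1). The sign is that of the odd power of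
        -- -1.
        -(2 * N + 1) * ∑ s ∈ Finset.range (a + 1), ((2 * a + 1).choose (2 * s + 1) : K) *
        risingFactorial (1 / 2) (a - s) * 2 ^ (a - s) *
        (4 ^ s * risingFactorial ((N + 1 : ℕ) : K) s *
          risingFactorial (N + (1 / 2 + 1) : K) s) *
        F (2 * N + 1) (2 * d + (2 * a + 1 - (2 * s + 1))) (2 * s + 1) := by
      rw [Finset.mul_sum]
      refine Finset.sum_congr rfl fun s hs => ?_
      have e1 : ((2 * N + 1 : ℕ) : K) + 1 = 2 * (N + 1 : ℕ) := by push_cast; ring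
      have e2 : ((N + 1 : ℕ) + 1 / 2 : K) = N + (1 / 2 + 1) := by push_cast; ring
      rw [show 2 * a + 1 - (2 * s + 1) = 2 * (a - s) by omega, gaussianMoment_two_mul, pow_succ,
        pow_mul, neg_one_sq, one_pow, risingFactorial_succ', e1, risingFactorial_two_mul, e2]
      push_cast
      ring
    rw [hsum, evenMinorConst, oddDoubleFactorial_two_mul_add_one]
    have h1 : (2 * a + 1 + 2 * d) / 2 = a + d := by omega
    have h2 : ((-1 : K)) ^ (2 * a + 1 + 2 * d) = -1 := Odd.neg_one_pow ⟨a + d, by ring⟩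
    rw [h1, h2, add_comm (d : K)]
    have h4 : (2 * N + 1 : K) ≠ 0 := by exact_mod_cast Nat.succ_ne_zero (2 * N)
    rw [risingFactorial_half_add_one N] at key
    refine mul_right_cancel₀ (mul_ne_zero h0 h4) ?_
    calc _ = -(2 * N + 1 : K) * _ := by rw [mul_assoc, mul_assoc, mul_comm (risingFactorial _ _),
             ← mul_assoc (∑ _ ∈ _, _)]
      _ = _ := congrArg _ key
      _ = _ := by
        field_simp
        ring_nf

theorem IsMinorMoment.formula (hF : IsMinorMoment F) (N : ℕ) :
    OddMinorFormula F N ∧ EvenMinorFormula F (N + 1) := by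
  induction N with
  | zero => exact ⟨hF.oddMinorFormula_zero, hF.evenMinorFormula_of_odd hF.oddMinorFormula_zero⟩
  | succ N ih =>
    have h := hF.oddMinorFormula_of_even ih.2
    exact ⟨h, hF.evenMinorFormula_of_odd h⟩

end MomentRecursion

-- From the closed form to the products.

section MomentProducts

variable {K : Type*} [Field K] [CharZero K] {F : ℕ → ℕ → ℕ → K}

theorem prod_Icc_two_mul_add_two_mul_sub_one (m c : ℕ) :
    ∏ j ∈ Finset.Icc 1 c, (2 * (m : K) + 2 * (j : K) - 1) =
      2 ^ c * risingFactorial (m + 1 / 2 : K) c := by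
  induction c with
  | zero => simp
  | succ c ih =>
    rw [Finset.prod_Icc_succ_top (by omega), ih, risingFactorial_succ]
    push_cast
    field_simp
    ring

/-- Evaluates the j = N+1 factor of the even-order product. After clearing denominators it is the
degree-dependent part, up to sign, of the two steps from `evenMinorConst` at N to N+1. -/
theorem prod_Icc_two_mul_div_two_add (N k : ℕ) :
    (∏ i ∈ Finset.Icc 1 k, (2 * ((i / 2 : ℕ) : K) + 2 * ((N + 1 : ℕ) : K) - 1)) *
      (risingFactorial (1 / 2) N * risingFactorial (1 / 2) (N + 1)) =
      4 ^ (k / 2) * risingFactorial (1 / 2) (k / 2 + N + 1) *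
        risingFactorial (1 / 2 + ((k % 2 : ℕ) : K)) (k / 2 + N) := by
  have heven : ∀ c : ℕ, (∏ i ∈ Finset.Icc 1 (2 * c),
      (2 * ((i / 2 : ℕ) : K) + 2 * ((N + 1 : ℕ) : K) - 1)) *
      (risingFactorial (1 / 2) N * risingFactorial (1 / 2) (N + 1)) =
      4 ^ c * risingFactorial (1 / 2) (c + N + 1) * risingFactorial (1 / 2) (c + N) := by
    intro c
    induction c with
    | zero => simp; ring
    | succ c ih =>
      rw [show 2 * (c + 1) = 2 * c + 1 + 1 by ring, Finset.prod_Icc_succ_top (by omega),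
        Finset.prod_Icc_succ_top (by omega), show (2 * c + 1) / 2 = c by omega,
        show (2 * c + 1 + 1) / 2 = c + 1 by omega, show c + 1 + N = c + N + 1 by ring,
        risingFactorial_succ _ (c + N + 1)]
      rw [risingFactorial_succ _ (c + N)] at ih ⊢
      push_cast at ih ⊢
      linear_combination (2 * c + 2 * (N + 1) - 1 : K) * (2 * (c + 1) + 2 * (N + 1) - 1) * ih
  rcases Nat.even_or_odd' k with ⟨c, rfl | rfl⟩
  · simpa using heven c
  · rw [Finset.prod_Icc_succ_top (by omega), show (2 * c + 1) / 2 = c by omega,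
      show (2 * c + 1) % 2 = 1 by omega, Nat.cast_one, risingFactorial_half_add_one]
    have h := heven c
    push_cast at h ⊢
    linear_combination (2 * c + 2 * (N + 1) - 1 : K) * h

theorem OddMinorFormula.apply_zero {N : ℕ} (h : OddMinorFormula F N) (c : ℕ) :
    F (2 * N + 1) (2 * c) 0 * risingFactorial (1 / 2) N =
      oddDoubleFactorial K (2 * c) * oddMinorConst K N (2 * c) := by
  have := h.2 c 0
  simpa [oddDoubleFactorial_two_mul] using this

theorem EvenMinorFormula.apply_zero {N : ℕ} (h : EvenMinorFormula F N) (k : ℕ) :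
    F (2 * N) k 0 * risingFactorial (1 / 2) N =
      oddDoubleFactorial K k * evenMinorConst K N k := by
  have := h.2 k 0
  simpa using this

theorem IsMinorMoment.evenMinorFormula_apply_zero (hF : IsMinorMoment F)
    (hzero : ∀ p q, F 0 p q = 1) (N k : ℕ) :
    F (2 * N) k 0 * risingFactorial (1 / 2) N =
      oddDoubleFactorial K k * evenMinorConst K N k := by
  cases N with
  | zero => simp [hzero, evenMinorConst, mul_inv_cancel₀ (oddDoubleFactorial_ne_zero (K := K) k)]
  | succ N => exact (hF.formula N).2.apply_zero k

/-- The moments of even degree of the determinant. -/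
theorem IsMinorMoment.even_degree (hF : IsMinorMoment F) (hzero : ∀ p q, F 0 p q = 1)
    (n c : ℕ) : F n (2 * c) 0 =
      ∏ i ∈ Finset.Icc 1 n, ∏ j ∈ Finset.Icc 1 c, (2 * ((i / 2 : ℕ) : K) + 2 * (j : K) - 1) := by
  induction n with
  | zero => simp [hzero]
  | succ n ih =>
    rw [Finset.prod_Icc_succ_top (by omega), ← ih, prod_Icc_two_mul_add_two_mul_sub_one]
    -- Raising the order from n to n+1 multiplies the moment by 2^c (m + 1/2)_c with m = ⌊(n+1)/2⌋;
    -- the parity of n selects which of the two constants is unfolded.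
    rcases Nat.even_or_odd' n with ⟨N, rfl | rfl⟩
    · have h1 := (hF.formula N).1.apply_zero c
      have h2 := hF.evenMinorFormula_apply_zero hzero N (2 * c)
      have h0 := risingFactorial_half_ne_zero' (K := K) N
      rw [show (2 * N + 1) / 2 = N by omega]
      have h3 := risingFactorial_add (1 / 2 : K) N c
      rw [oddMinorConst, show 2 * c / 2 = c by omega, show 2 * c % 2 = 0 by omega, Nat.cast_zero,
        add_zero, add_comm c N, h3, add_comm (1 / 2 : K)] at h1
      have h4 : (2 ^ c * (risingFactorial (1 / 2 : K) N * risingFactorial (N + 1 / 2 : K) c) /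
        risingFactorial (1 / 2) N) = 2 ^ c * risingFactorial (N + 1 / 2 : K) c := by
        field_simp
      rw [h4] at h1
      refine mul_right_cancel₀ h0 ?_
      linear_combination h1 - 2 ^ c * risingFactorial (N + 1 / 2 : K) c * h2
    · have h1 := (hF.formula N).1.apply_zero c
      have h2 := hF.evenMinorFormula_apply_zero hzero (N + 1) (2 * c)
      have h0 := risingFactorial_half_ne_zero' (K := K) (N + 1)
      have h0' := risingFactorial_half_ne_zero' (K := K) N
      rw [show (2 * N + 1 + 1) / 2 = N + 1 by omega]
      have h3 := risingFactorial_add (1 / 2 : K) (N + 1) c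
      rw [evenMinorConst, show 2 * c / 2 = c by omega,
        show c + N + 1 = N + 1 + c by ring, h3, add_comm (1 / 2 : K), pow_mul, neg_one_sq,
        one_pow, one_mul] at h2
      rw [show 2 * N + 1 + 1 = 2 * (N + 1) by ring]
      refine mul_right_cancel₀ h0 (h2.trans ?_)
      have h4 : 2 ^ c * (risingFactorial (1 / 2 : K) (N + 1) *
          risingFactorial ((N + 1 : ℕ) + 1 / 2 : K) c) / risingFactorial (1 / 2) N *
          risingFactorial (1 / 2) N = 2 ^ c * (risingFactorial (1 / 2 : K) (N + 1) *
          risingFactorial ((N + 1 : ℕ) + 1 / 2 : K) c) := by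
        field_simp
      refine mul_right_cancel₀ h0' ?_
      linear_combination (oddDoubleFactorial K (2 * c) * oddMinorConst K N (2 * c)) * h4 -
        2 ^ c * (risingFactorial (1 / 2 : K) (N + 1) *
          risingFactorial ((N + 1 : ℕ) + 1 / 2 : K) c) * h1

/-- The moments of the determinant in even order. -/
theorem IsMinorMoment.even_order (hF : IsMinorMoment F) (hzero : ∀ p q, F 0 p q = 1)
    (N k : ℕ) : F (2 * N) k 0 = (-1) ^ (N * k) *
      ∏ i ∈ Finset.Icc 1 k, ∏ j ∈ Finset.Icc 1 N, (2 * ((i / 2 : ℕ) : K) + 2 * (j : K) - 1) := by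
  induction N with
  | zero => simp [hzero]
  | succ N ih =>
    simp_rw [Finset.prod_Icc_succ_top (show 1 ≤ N + 1 by omega)]
    rw [Finset.prod_mul_distrib, add_mul, one_mul, pow_add]
    have h1 := hF.evenMinorFormula_apply_zero hzero N k
    have h2 := hF.evenMinorFormula_apply_zero hzero (N + 1) k
    have h3 := prod_Icc_two_mul_div_two_add (K := K) N k
    have h0 := risingFactorial_half_ne_zero' (K := K) (N + 1)
    have h0' := risingFactorial_half_ne_zero' (K := K) N
    rw [evenMinorConst, oddMinorConst] at h2
    have h4 : F (2 * (N + 1)) k 0 * risingFactorial (1 / 2) (N + 1) * risingFactorial (1 / 2) N =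
        (-1) ^ k * (4 ^ (k / 2) * risingFactorial (1 / 2) (k / 2 + N + 1) *
        risingFactorial (1 / 2 + ((k % 2 : ℕ) : K)) (k / 2 + N)) * F (2 * N) k 0 := by
      refine mul_right_cancel₀ h0' ?_
      rw [h2, mul_assoc _ (F (2 * N) k 0), h1, show (4 : K) = 2 * 2 by norm_num, mul_pow]
      field_simp
    refine mul_right_cancel₀ (mul_ne_zero h0 h0') ?_
    rw [← mul_assoc, h4, ih, ← h3]
    ring

theorem IsMinorMoment.odd_order_odd_degree (hF : IsMinorMoment F) {n k : ℕ} (hn : Odd n)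
    (hk : Odd k) : F n k 0 = 0 := by
  obtain ⟨N, rfl⟩ := hn
  exact (hF.formula N).1.1 k 0 hk

end MomentProducts

-- Integrability of polynomials in the entries.

section AllMoments

variable {Ω Ω' : Type*} [MeasurableSpace Ω] [MeasurableSpace Ω'] {μ : Measure Ω} {ν : Measure Ω'}

/-- A complex random variable with finite absolute moments of all orders. -/
def HasAllMoments (f : Ω → ℂ) (μ : Measure Ω) : Prop :=
  ∀ p : ENNReal, p ≠ ⊤ → MemLp f p μ

namespace HasAllMoments

variable {f g : Ω → ℂ}

theorem integrable (hf : HasAllMoments f μ) : Integrable f μ :=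
  memLp_one_iff_integrable.1 (hf 1 ENNReal.one_ne_top)

theorem add (hf : HasAllMoments f μ) (hg : HasAllMoments g μ) :
    HasAllMoments (fun x => f x + g x) μ :=
  fun p hp => (hf p hp).add (hg p hp)

theorem neg (hf : HasAllMoments f μ) : HasAllMoments (fun x => -f x) μ :=
  fun p hp => (hf p hp).neg

theorem mul (hf : HasAllMoments f μ) (hg : HasAllMoments g μ) :
    HasAllMoments (fun x => f x * g x) μ := fun p hp => by
  -- Hölder with exponents 2p, 2p and p: having all finite moments is what makes the class closed
  -- under products.
  have h2 : 2 * p ≠ ⊤ := ENNReal.mul_ne_top ENNReal.ofNat_ne_top hp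
  have : ENNReal.HolderTriple (2 * p) (2 * p) p := ⟨by
    rw [ENNReal.mul_inv (Or.inl two_ne_zero) (Or.inl ENNReal.ofNat_ne_top), ← add_mul,
      ENNReal.inv_two_add_inv_two, one_mul]⟩
  exact (hg _ h2).mul (hf _ h2)

theorem const [IsFiniteMeasure μ] (c : ℂ) : HasAllMoments (fun _ => c) μ :=
  fun _ _ => memLp_const c

theorem pow [IsFiniteMeasure μ] (hf : HasAllMoments f μ) (n : ℕ) :
    HasAllMoments (fun x => f x ^ n) μ := by
  induction n with
  | zero => simpa using const 1
  | succ n ih => simpa only [pow_succ] using ih.mul hf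

theorem sum {ι : Type*} {s : Finset ι} [IsFiniteMeasure μ] {f : ι → Ω → ℂ}
    (hf : ∀ i ∈ s, HasAllMoments (f i) μ) : HasAllMoments (fun x => ∑ i ∈ s, f i x) μ :=
  fun p hp => memLp_finsetSum s fun i hi => hf i hi p hp

theorem prod {ι : Type*} {s : Finset ι} [IsFiniteMeasure μ] {f : ι → Ω → ℂ}
    (hf : ∀ i ∈ s, HasAllMoments (f i) μ) : HasAllMoments (fun x => ∏ i ∈ s, f i x) μ := by
  classical
  induction s using Finset.induction_on with
  | empty => simpa using const 1
  | insert a s ha ih =>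
    simp only [Finset.prod_insert ha]
    exact (hf a (Finset.mem_insert_self _ _)).mul
      (ih fun i hi => hf i (Finset.mem_insert_of_mem hi))

theorem comp {f : Ω' → ℂ} (hf : HasAllMoments f ν) {φ : Ω → Ω'} (hφ : MeasurePreserving φ μ ν) :
    HasAllMoments (fun x => f (φ x)) μ :=
  fun p hp => (hf p hp).comp_measurePreserving hφ

theorem det {n : ℕ} [IsFiniteMeasure μ] {A : Ω → Matrix (Fin n) (Fin n) ℂ}
    (hA : ∀ i j, HasAllMoments (fun x => A x i j) μ) : HasAllMoments (fun x => (A x).det) μ := by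
  simp only [Matrix.det_apply']
  exact sum fun σ _ => (const _).mul (prod fun i _ => hA _ _)

end HasAllMoments

theorem hasAllMoments_gaussianReal (v : NNReal) :
    HasAllMoments (fun x : ℝ => (x : ℂ)) (gaussianReal 0 v) :=
  fun p hp => (memLp_id_gaussianReal' p hp).ofReal

end AllMoments

-- Moments of Gaussian variables and of their sums of squares.

section GaussianMoments

theorem Real.Gamma_nat_add_half_eq_risingFactorial (m : ℕ) :
    Real.Gamma (m + 1 / 2) = risingFactorial (1 / 2) m * √Real.pi := by
  induction m with
  | zero => simpa using Real.Gamma_one_half_eq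
  | succ m ih =>
    rw [risingFactorial_succ, show ((m + 1 : ℕ) : ℝ) + 1 / 2 = (m + 1 / 2) + 1 by push_cast; ring,
      Real.Gamma_add_one (by positivity), ih]
    ring

theorem integral_pow_two_mul_gaussianReal {v : NNReal} (hv : v ≠ 0) (m : ℕ) :
    ∫ x, x ^ (2 * m) ∂(gaussianReal 0 v) = (2 * v) ^ m * risingFactorial (1 / 2) m := by
  have hv' : (0 : ℝ) < v := NNReal.coe_pos.2 (pos_iff_ne_zero.2 hv)
  have h1 : ∀ x : ℝ, gaussianPDFReal 0 v x • x ^ (2 * m) =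
      (√(2 * Real.pi * v))⁻¹ * (fun y => y ^ (2 * m) * Real.exp (-(2 * (v : ℝ))⁻¹ * y ^ 2)) |x| := by
    intro x
    simp only [gaussianPDFReal, sub_zero, smul_eq_mul, pow_mul, sq_abs]
    rw [show -x ^ 2 / (2 * (v : ℝ)) = -(2 * (v : ℝ))⁻¹ * x ^ 2 by field_simp]
    ring
  rw [integral_gaussianReal_eq_integral_smul hv]
  simp_rw [h1]
  rw [integral_const_mul,
    integral_comp_abs (f := fun y => y ^ (2 * m) * Real.exp (-(2 * (v : ℝ))⁻¹ * y ^ 2))]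
  have h2 := integral_rpow_mul_exp_neg_mul_rpow (p := 2) (q := (2 * m : ℕ)) (b := (2 * v : ℝ)⁻¹)
    two_pos (by linarith [Nat.cast_nonneg (α := ℝ) (2 * m)]) (by positivity)
  simp only [Real.rpow_natCast, Real.rpow_two] at h2
  rw [h2]
  have h3 : ((2 * m : ℕ) + 1 : ℝ) / 2 = m + 1 / 2 := by push_cast; ring
  have h4 : (2 * (v : ℝ))⁻¹ ^ (-((2 * m : ℕ) + 1 : ℝ) / 2) = (2 * v) ^ m * √(2 * v) := by
    rw [neg_div, h3, Real.inv_rpow (by positivity), Real.rpow_neg (by positivity), inv_inv,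
      Real.rpow_add (by positivity), Real.rpow_natCast, Real.sqrt_eq_rpow]
  rw [h4, h3, Real.Gamma_nat_add_half_eq_risingFactorial,
    show 2 * Real.pi * v = 2 * v * Real.pi by ring, Real.sqrt_mul (by positivity)]
  have : √(2 * (v : ℝ)) ≠ 0 := by positivity
  have : √Real.pi ≠ 0 := by positivity
  field_simp

theorem ofReal_risingFactorial (x : ℝ) (m : ℕ) :
    ((risingFactorial x m : ℝ) : ℂ) = risingFactorial (x : ℂ) m := by
  simp [risingFactorial]

theorem integral_ofReal_pow_two_mul_gaussianReal {v : NNReal} (hv : v ≠ 0) (m : ℕ) :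
    ∫ x : ℝ, (x : ℂ) ^ (2 * m) ∂(gaussianReal 0 v) =
      (2 * (v : ℝ)) ^ m * risingFactorial (1 / 2) m := by
  have h := integral_pow_two_mul_gaussianReal hv m
  simp_rw [← Complex.ofReal_pow]
  rw [integral_complex_ofReal, h]
  push_cast [ofReal_risingFactorial]
  rfl

theorem integral_ofReal_pow_gaussianReal_one (r : ℕ) :
    ∫ x : ℝ, (x : ℂ) ^ r ∂(gaussianReal 0 1) = gaussianMoment ℂ r := by
  rcases Nat.even_or_odd' r with ⟨m, rfl | hr⟩
  · rw [integral_ofReal_pow_two_mul_gaussianReal one_ne_zero, gaussianMoment_two_mul]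
    simp
  · have hr : Odd r := ⟨m, hr⟩
    rw [gaussianMoment_of_odd hr]
    have h : ∫ x : ℝ, (x : ℂ) ^ r ∂(gaussianReal 0 1) =
        ∫ x : ℝ, ((-x : ℝ) : ℂ) ^ r ∂(gaussianReal 0 1) := by
      conv_lhs => rw [← neg_zero, ← gaussianReal_map_neg]
      rw [integral_map (by fun_prop) (by fun_prop)]
    simp only [Complex.ofReal_neg, hr.neg_pow, integral_neg] at h
    exact self_eq_neg.1 h

theorem hasAllMoments_pi_gaussianReal (m : ℕ) (v : NNReal) (i : Fin m) :
    HasAllMoments (fun x : Fin m → ℝ => (x i : ℂ))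
      (Measure.pi fun _ : Fin m => gaussianReal 0 v) :=
  (hasAllMoments_gaussianReal v).comp (measurePreserving_eval _ i)

theorem hasAllMoments_sum_sq (m : ℕ) (v : NNReal) :
    HasAllMoments (fun x : Fin m → ℝ => ∑ i, (x i : ℂ) ^ 2)
      (Measure.pi fun _ : Fin m => gaussianReal 0 v) :=
  HasAllMoments.sum fun i _ => (hasAllMoments_pi_gaussianReal m v i).pow 2

/-- Moments (x)_s are those of a gamma law, and independent gamma laws add their parameters: the
binomial theorem and independence give the Chu–Vandermonde sum. -/
theorem integral_add_pow_prod {α β : Type*} [MeasurableSpace α] [MeasurableSpace β]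
    {μ : Measure α} {ν : Measure β} [IsProbabilityMeasure μ] [IsProbabilityMeasure ν]
    {f : α → ℂ} {g : β → ℂ} (hf : HasAllMoments f μ) (hg : HasAllMoments g ν) {x y : ℂ}
    (hfx : ∀ s, ∫ a, f a ^ s ∂μ = risingFactorial x s)
    (hgy : ∀ s, ∫ b, g b ^ s ∂ν = risingFactorial y s) (s : ℕ) :
    ∫ z, (f z.1 + g z.2) ^ s ∂(μ.prod ν) = risingFactorial (x + y) s := by
  simp_rw [add_pow]
  rw [integral_finsetSum]
  · rw [← sum_choose_mul_risingFactorial]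
    refine Finset.sum_congr rfl fun t _ => ?_
    rw [integral_mul_const, integral_prod_mul (fun a => f a ^ t) (fun b => g b ^ (s - t)), hfx,
      hgy]
    ring
  · exact fun t _ => ((hf.pow t).integrable.mul_prod (hg.pow (s - t)).integrable).mul_const _

/-- With variance 1/2 each square has moments (1/2)_s without scale factor, so m of them add up to
parameter m/2. -/
theorem integral_sum_sq_pow (m s : ℕ) :
    ∫ x : Fin m → ℝ, (∑ i, (x i : ℂ) ^ 2) ^ s ∂(Measure.pi fun _ : Fin m => gaussianReal 0 (1 / 2)) =
      risingFactorial (m / 2 : ℂ) s := by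
  induction m generalizing s with
  | zero =>
    cases s with
    | zero => simp
    | succ s => simp [risingFactorial_succ']
  | succ m ih =>
    have hmp := measurePreserving_piFinSuccAbove (α := fun _ : Fin (m + 1) => ℝ)
      (fun _ => gaussianReal 0 (1 / 2)) 0
    have h := hmp.integral_comp (MeasurableEquiv.measurableEmbedding _)
      (fun z : ℝ × (Fin m → ℝ) => ((z.1 : ℂ) ^ 2 + ∑ i, (z.2 i : ℂ) ^ 2) ^ s)
    have h' := integral_add_pow_prod (x := 1 / 2) (y := m / 2)
      ((hasAllMoments_gaussianReal (1 / 2)).pow 2) (hasAllMoments_sum_sq m (1 / 2))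
      (fun t => by
        simp_rw [← pow_mul]
        rw [integral_ofReal_pow_two_mul_gaussianReal (by norm_num)]
        simp) ih s
    rw [show ((m + 1 : ℕ) : ℂ) / 2 = 1 / 2 + m / 2 by push_cast; ring, ← h']
    simp_rw [Fin.sum_univ_succ]
    exact h

theorem integral_sum_sq_add_sum_sq_pow (m s : ℕ) :
    ∫ z : (Fin m → ℝ) × (Fin m → ℝ), (∑ i, (z.1 i : ℂ) ^ 2 + ∑ i, (z.2 i : ℂ) ^ 2) ^ s
      ∂((Measure.pi fun _ : Fin m => gaussianReal 0 (1 / 2)).prod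
        (Measure.pi fun _ : Fin m => gaussianReal 0 (1 / 2))) = risingFactorial (m : ℂ) s := by
  rw [integral_add_pow_prod (hasAllMoments_sum_sq m _) (hasAllMoments_sum_sq m _)
    (integral_sum_sq_pow m) (integral_sum_sq_pow m), add_halves]

end GaussianMoments

-- Coordinates of the ensemble and the splitting off of a border.

section NestedProduct

/-- Boxes in the inner product form a generating π-system with finite spanning sets, so it is enough
to test boxes of boxes. -/
theorem pi_pi_eq_of_boxes {ι κ α : Type*} [Fintype ι] [Fintype κ] [MeasurableSpace α]
    (μ : ι → κ → Measure α) [∀ i j, SigmaFinite (μ i j)] {ν : Measure (ι → κ → α)}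
    (h : ∀ s : ι → κ → Set α, (∀ i j, MeasurableSet (s i j)) →
      ν (Set.univ.pi fun i => Set.univ.pi (s i)) = ∏ i, ∏ j, μ i j (s i j)) :
    Measure.pi (fun i => Measure.pi (μ i)) = ν := by
  refine Measure.pi_eq_generateFrom
    (C := fun _ => Set.univ.pi '' Set.univ.pi fun _ => {s : Set α | MeasurableSet s})
    (fun _ => generateFrom_pi) (fun _ => isPiSystem_pi)
    (fun i => Measure.FiniteSpanningSetsIn.pi fun j => (μ i j).toFiniteSpanningSetsIn)
    fun s hs => ?_
  choose t ht hts using hs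
  obtain rfl : (fun i => Set.univ.pi (t i)) = s := funext hts
  rw [h t fun i j => ht i j trivial]
  simp [Measure.pi_pi]

end NestedProduct

section Coordinates

/-- The law of the coordinates of a `GUE` matrix of order `n`. -/
noncomputable abbrev gueCoords (n : ℕ) : Measure (Fin n → Fin n → ℝ) :=
  Measure.pi fun i : Fin n => Measure.pi fun j : Fin n =>
    gaussianReal 0 (if i = j then 1 else 1 / 2)

theorem measurePreserving_hermitianOfCoords (n : ℕ) :
    MeasurePreserving hermitianOfCoords (gueCoords n) (gue n) :=
  ⟨measurable_hermitianOfCoords, rfl⟩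

/-- The law of a vector of independent normal variables of variance `1 / 2`. -/
noncomputable abbrev halfGaussian (n : ℕ) : Measure (Fin n → ℝ) :=
  Measure.pi fun _ : Fin n => gaussianReal 0 (1 / 2)

/-- Coordinates of order `n + 1` from the corner `a`, the row `u`, the column `w` and the
coordinates `y` of order `n`. -/
def borderCoords {n : ℕ} (z : (ℝ × ((Fin n → ℝ) × (Fin n → ℝ))) × (Fin n → Fin n → ℝ)) :
    Fin (n + 1) → Fin (n + 1) → ℝ :=
  Fin.cons (Fin.cons z.1.1 z.1.2.1) fun i => Fin.cons (z.1.2.2 i) (z.2 i)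

theorem measurable_borderCoords {n : ℕ} : Measurable (borderCoords (n := n)) := by
  refine measurable_pi_lambda _ fun i => measurable_pi_lambda _ fun j => ?_
  refine Fin.cases ?_ (fun i => ?_) i <;> refine Fin.cases ?_ (fun j => ?_) j <;>
    simp only [borderCoords, Fin.cons_zero, Fin.cons_succ] <;> fun_prop

theorem measurePreserving_borderCoords (n : ℕ) :
    MeasurePreserving borderCoords
      (((gaussianReal 0 1).prod ((halfGaussian n).prod (halfGaussian n))).prod (gueCoords n))
      (gueCoords (n + 1)) := by
  refine ⟨measurable_borderCoords, ?_⟩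
  refine (pi_pi_eq_of_boxes _ fun s hs => ?_).symm
  have hm : MeasurableSet (Set.univ.pi fun i => Set.univ.pi (s i)) :=
    MeasurableSet.univ_pi fun i => MeasurableSet.univ_pi (hs i)
  rw [Measure.map_apply measurable_borderCoords hm]
  have hpre : borderCoords ⁻¹' (Set.univ.pi fun i => Set.univ.pi (s i)) =
      (s 0 0 ×ˢ ((Set.univ.pi fun j : Fin n => s 0 j.succ) ×ˢ
        (Set.univ.pi fun i : Fin n => s i.succ 0))) ×ˢ
        (Set.univ.pi fun i : Fin n => Set.univ.pi fun j : Fin n => s i.succ j.succ) := by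
    ext z
    simp only [borderCoords, Set.mem_preimage, Set.mem_univ_pi, Fin.forall_fin_succ,
      Fin.cons_zero, Fin.cons_succ, Set.mem_prod, forall_and]
    tauto
  rw [hpre]
  simp only [Measure.prod_prod, Measure.pi_pi, Fin.prod_univ_succ, Finset.prod_mul_distrib]
  simp [Fin.succ_ne_zero, (Fin.succ_ne_zero _).symm]
  ring

end Coordinates

-- Unitary invariance.

section UnitaryInvariance

variable {n : ℕ}

/-- The normalized coordinates of a Hermitian matrix, orthonormal for the Frobenius norm. -/
noncomputable def isoCoords (M : Matrix (Fin n) (Fin n) ℂ) :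
    EuclideanSpace ℝ (Fin n × Fin n) :=
  WithLp.toLp 2 fun p =>
    if p.1 = p.2 then (M p.1 p.2).re
    else if p.1 < p.2 then √2 * (M p.1 p.2).re else √2 * (M p.2 p.1).im

/-- The Hermitian matrix with given normalized coordinates. -/
noncomputable def ofIsoCoords (g : EuclideanSpace ℝ (Fin n × Fin n)) :
    Matrix (Fin n) (Fin n) ℂ :=
  hermitianOfCoords fun i j => (if i = j then 1 else (√2)⁻¹) * g (i, j)

theorem isoCoords_add (M N : Matrix (Fin n) (Fin n) ℂ) :
    isoCoords (M + N) = isoCoords M + isoCoords N := by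
  ext p
  simp only [isoCoords, PiLp.add_apply, Matrix.add_apply, Complex.add_re, Complex.add_im]
  split_ifs <;> ring

theorem isoCoords_smul (c : ℝ) (M : Matrix (Fin n) (Fin n) ℂ) :
    isoCoords (c • M) = c • isoCoords M := by
  ext p
  simp only [isoCoords, PiLp.smul_apply, Matrix.smul_apply, Complex.smul_re, Complex.smul_im,
    smul_eq_mul]
  split_ifs <;> ring

theorem ofIsoCoords_add (g h : EuclideanSpace ℝ (Fin n × Fin n)) :
    ofIsoCoords (g + h) = ofIsoCoords g + ofIsoCoords h := by
  ext i j
  simp only [ofIsoCoords, hermitianOfCoords, Matrix.of_apply, Matrix.add_apply, PiLp.add_apply]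
  split_ifs <;> push_cast <;> ring

theorem ofIsoCoords_smul (c : ℝ) (g : EuclideanSpace ℝ (Fin n × Fin n)) :
    ofIsoCoords (c • g) = c • ofIsoCoords g := by
  ext i j
  simp only [ofIsoCoords, hermitianOfCoords, Matrix.of_apply, Matrix.smul_apply,
    PiLp.smul_apply, smul_eq_mul, Complex.real_smul]
  split_ifs <;> push_cast <;> ring

theorem ofIsoCoords_isoCoords {M : Matrix (Fin n) (Fin n) ℂ} (hM : M.IsHermitian) :
    ofIsoCoords (isoCoords M) = M := by
  have h2 : (√2)⁻¹ * √2 = 1 := inv_mul_cancel₀ (by positivity)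
  ext i j
  rcases lt_trichotomy i j with h | h | h
  · simp only [ofIsoCoords, isoCoords, hermitianOfCoords, Matrix.of_apply, h.ne, h.ne', h,
      h.not_gt, if_false, if_true, ← mul_assoc, h2, one_mul]
    exact Complex.re_add_im _
  · subst h
    simpa [ofIsoCoords, isoCoords, hermitianOfCoords] using hM.coe_re_apply_self i
  · simp only [ofIsoCoords, isoCoords, hermitianOfCoords, Matrix.of_apply, h.ne, h.ne', h,
      h.not_gt, if_false, if_true, ← mul_assoc, h2, one_mul]
    rw [← hM.apply i j]
    apply Complex.ext <;> simp

theorem normSq_ofIsoCoords (g : EuclideanSpace ℝ (Fin n × Fin n)) (i j : Fin n) :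
    Complex.normSq (ofIsoCoords g i j) = (g (i, j) ^ 2 + g (j, i) ^ 2) / 2 := by
  have h2 : (√2)⁻¹ * (√2)⁻¹ = (1 / 2 : ℝ) := by
    rw [← mul_inv, Real.mul_self_sqrt zero_le_two, one_div]
  rcases lt_trichotomy i j with h | h | h
  · simp only [ofIsoCoords, hermitianOfCoords, Matrix.of_apply, h.ne, h.ne', h,
      if_false, if_true, Complex.normSq_add_mul_I]
    linear_combination (g (i, j) ^ 2 + g (j, i) ^ 2) * h2
  · subst h
    simp [ofIsoCoords, hermitianOfCoords, Complex.normSq_ofReal]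
    ring
  · simp only [ofIsoCoords, hermitianOfCoords, Matrix.of_apply, h.ne, h.ne', h.not_gt,
      if_false, sub_eq_add_neg, ← neg_mul, ← Complex.ofReal_neg, Complex.normSq_add_mul_I]
    linear_combination (g (i, j) ^ 2 + g (j, i) ^ 2) * h2

/-- Each off-diagonal coordinate enters two entries, which the factor 1/√2 compensates; so the
Euclidean norm is the Frobenius norm, which unitary conjugation preserves. -/
theorem trace_ofIsoCoords_mul_conjTranspose (g : EuclideanSpace ℝ (Fin n × Fin n)) :
    (ofIsoCoords g * (ofIsoCoords g).conjTranspose).trace = ((‖g‖ ^ 2 : ℝ) : ℂ) := by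
  have h1 : ‖g‖ ^ 2 = ∑ i, ∑ j, (g (i, j) ^ 2 + g (j, i) ^ 2) / 2 := by
    rw [EuclideanSpace.real_norm_sq_eq, Fintype.sum_prod_type]
    simp_rw [← Finset.sum_div, Finset.sum_add_distrib]
    rw [Finset.sum_comm (f := fun i j => g (j, i) ^ 2)]
    ring
  simp only [h1, Matrix.trace, Matrix.diag_apply, Matrix.mul_apply, Matrix.conjTranspose_apply,
    Complex.ofReal_sum, ← normSq_ofIsoCoords, Complex.star_def, Complex.mul_conj]

theorem measurable_ofIsoCoords : Measurable (ofIsoCoords (n := n)) :=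
  measurable_hermitianOfCoords.comp (by fun_prop)

/-- The same factor 1/√2 turns variance 1 into the variance 1/2 of the off-diagonal coordinates. -/
theorem map_ofIsoCoords_stdGaussian :
    (stdGaussian (EuclideanSpace ℝ (Fin n × Fin n))).map ofIsoCoords = gue n := by
  let c : Fin n → Fin n → ℝ := fun i j => if i = j then 1 else (√2)⁻¹
  let φ : (Fin n × Fin n → ℝ) → Fin n → Fin n → ℝ := fun g i j => c i j * g (i, j)
  have hφ : Measurable φ := by fun_prop
  have h : gueCoords n = (Measure.pi fun _ => gaussianReal 0 1).map φ := by
    refine pi_pi_eq_of_boxes _ fun s hs => ?_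
    have hm : MeasurableSet (Set.univ.pi fun i => Set.univ.pi (s i)) :=
      MeasurableSet.univ_pi fun i => MeasurableSet.univ_pi (hs i)
    rw [Measure.map_apply hφ hm]
    have hpre : φ ⁻¹' (Set.univ.pi fun i => Set.univ.pi (s i)) =
        Set.univ.pi fun p : Fin n × Fin n => (fun x => c p.1 p.2 * x) ⁻¹' (s p.1 p.2) := by
      ext g
      simp [φ, Prod.forall]
    rw [hpre, Measure.pi_pi, Fintype.prod_prod_type]
    refine Finset.prod_congr rfl fun i _ => Finset.prod_congr rfl fun j _ => ?_
    rw [← Measure.map_apply (measurable_const_mul _) (hs i j), gaussianReal_map_const_mul,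
      mul_zero]
    congr 2
    apply NNReal.eq
    by_cases hij : i = j <;> simp [c, hij]
  rw [← map_pi_eq_stdGaussian, Measure.map_map measurable_ofIsoCoords (by fun_prop), gue]
  change _ = (gueCoords n).map _
  rw [h, Measure.map_map measurable_hermitianOfCoords hφ]
  rfl

theorem measurable_matrix_conj (U V : Matrix (Fin n) (Fin n) ℂ) :
    Measurable fun A : Matrix (Fin n) (Fin n) ℂ => U * A * V := by
  refine measurable_pi_lambda _ fun i => measurable_pi_lambda _ fun j => ?_
  have h : ∀ k l, Measurable fun A : Matrix (Fin n) (Fin n) ℂ => A k l := fun k l =>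
    (measurable_pi_apply l).comp (measurable_pi_apply k)
  simp only [Matrix.mul_apply]
  fun_prop

/-- The unitary invariance of the Gaussian unitary ensemble. -/
theorem measurePreserving_gue_conj {U : Matrix (Fin n) (Fin n) ℂ}
    (hU : U.conjTranspose * U = 1) :
    MeasurePreserving (fun A => U * A * U.conjTranspose) (gue n) (gue n) := by
  refine ⟨measurable_matrix_conj _ _, ?_⟩
  -- In orthonormal coordinates conjugation is a linear isometry of a finite-dimensional space,
  -- hence an isometric equivalence, and these preserve the standard Gaussian.
  let T : EuclideanSpace ℝ (Fin n × Fin n) →ₗ[ℝ] EuclideanSpace ℝ (Fin n × Fin n) :=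
    { toFun := fun g => isoCoords (U * ofIsoCoords g * U.conjTranspose)
      map_add' := fun g h => by
        rw [ofIsoCoords_add, Matrix.mul_add, Matrix.add_mul, isoCoords_add]
      map_smul' := fun c g => by
        rw [ofIsoCoords_smul, Matrix.mul_smul, Matrix.smul_mul, isoCoords_smul]
        rfl }
  have hherm : ∀ g, (ofIsoCoords g : Matrix (Fin n) (Fin n) ℂ).IsHermitian := fun g =>
    hermitianOfCoords_isHermitian _
  have hT : ∀ g, ofIsoCoords (T g) = U * ofIsoCoords g * U.conjTranspose := fun g =>
    ofIsoCoords_isoCoords (Matrix.isHermitian_mul_mul_conjTranspose U (hherm g))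
  have hnorm : ∀ g, ‖T g‖ = ‖g‖ := fun g => by
    have h : ((‖T g‖ ^ 2 : ℝ) : ℂ) = ((‖g‖ ^ 2 : ℝ) : ℂ) := by
      rw [← trace_ofIsoCoords_mul_conjTranspose, ← trace_ofIsoCoords_mul_conjTranspose, hT]
      simp only [Matrix.conjTranspose_mul, Matrix.conjTranspose_conjTranspose]
      calc _ = (U * (ofIsoCoords g * (U.conjTranspose * U) * (ofIsoCoords g).conjTranspose *
            U.conjTranspose)).trace := by simp only [Matrix.mul_assoc]
        _ = _ := by
          rw [Matrix.trace_mul_comm, hU, Matrix.mul_one, Matrix.mul_assoc, hU, Matrix.mul_one]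
    exact (sq_eq_sq₀ (norm_nonneg _) (norm_nonneg _)).1 (Complex.ofReal_injective h)
  let e := (LinearIsometry.mk T hnorm).toLinearIsometryEquiv rfl
  have he : (stdGaussian (EuclideanSpace ℝ (Fin n × Fin n))).map e = stdGaussian _ :=
    stdGaussian_map e
  have he' : ofIsoCoords ∘ e = (fun A => U * A * U.conjTranspose) ∘ ofIsoCoords := funext hT
  rw [← map_ofIsoCoords_stdGaussian,
    Measure.map_map (measurable_matrix_conj _ _) measurable_ofIsoCoords, ← he',
    ← Measure.map_map measurable_ofIsoCoords e.continuous.measurable, he]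

end UnitaryInvariance

-- Determinants of bordered matrices.

section Bordered

variable {n : ℕ}

/-- The matrix with corner `a`, first row `v`, first column `star v` and lower right block `A`. -/
def borderedMatrix (a : ℂ) (v : Fin n → ℂ) (A : Matrix (Fin n) (Fin n) ℂ) :
    Matrix (Fin (n + 1)) (Fin (n + 1)) ℂ :=
  Matrix.of (Fin.cons (Fin.cons a v) fun i => Fin.cons (star (v i)) (A i))

@[simp] theorem borderedMatrix_zero_zero (a : ℂ) (v : Fin n → ℂ)
    (A : Matrix (Fin n) (Fin n) ℂ) : borderedMatrix a v A 0 0 = a := rfl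

@[simp] theorem borderedMatrix_zero_succ (a : ℂ) (v : Fin n → ℂ)
    (A : Matrix (Fin n) (Fin n) ℂ) (j : Fin n) : borderedMatrix a v A 0 j.succ = v j := rfl

@[simp] theorem borderedMatrix_succ_zero (a : ℂ) (v : Fin n → ℂ)
    (A : Matrix (Fin n) (Fin n) ℂ) (i : Fin n) :
    borderedMatrix a v A i.succ 0 = star (v i) := rfl

@[simp] theorem borderedMatrix_succ_succ (a : ℂ) (v : Fin n → ℂ)
    (A : Matrix (Fin n) (Fin n) ℂ) (i j : Fin n) :
    borderedMatrix a v A i.succ j.succ = A i j := rfl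

theorem borderedMatrix_submatrix_succ (a : ℂ) (v : Fin n → ℂ) (A : Matrix (Fin n) (Fin n) ℂ) :
    (borderedMatrix a v A).submatrix Fin.succ Fin.succ = A := rfl

/-- Coordinates above the diagonal hold real parts and those below hold imaginary parts, so the
border row and column of coordinates merge into one complex row. -/
theorem hermitianOfCoords_borderCoords
    (z : (ℝ × ((Fin n → ℝ) × (Fin n → ℝ))) × (Fin n → Fin n → ℝ)) :
    hermitianOfCoords (borderCoords z) = borderedMatrix (z.1.1 : ℂ)
      (fun j => (z.1.2.1 j : ℂ) + (z.1.2.2 j : ℂ) * Complex.I) (hermitianOfCoords z.2) := by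
  ext i j
  refine Fin.cases ?_ (fun i => ?_) i <;> refine Fin.cases ?_ (fun j => ?_) j
  · simp [hermitianOfCoords, borderCoords]
  · simp [hermitianOfCoords, borderCoords, (Fin.succ_ne_zero _).symm]
  · simp [hermitianOfCoords, borderCoords, Fin.succ_ne_zero, sub_eq_add_neg]
  · simp [hermitianOfCoords, borderCoords]

theorem borderedMatrix_one_zero_mul (U A : Matrix (Fin n) (Fin n) ℂ) (a : ℂ) (v : Fin n → ℂ) :
    borderedMatrix 1 0 U * borderedMatrix a v A * (borderedMatrix 1 0 U).conjTranspose =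
      borderedMatrix a (star (U.mulVec (star v))) (U * A * U.conjTranspose) := by
  ext i j
  refine Fin.cases ?_ (fun i => ?_) i <;> refine Fin.cases ?_ (fun j => ?_) j <;>
    simp [Matrix.mul_apply, Fin.sum_univ_succ, Matrix.mulVec, dotProduct, mul_comm]

/-- The left side comes from conjugating the whole bordered matrix by the unitary block matrix 1 ⊕
U. -/
theorem det_borderedMatrix_conj {U : Matrix (Fin n) (Fin n) ℂ} (hU : U.conjTranspose * U = 1)
    (A : Matrix (Fin n) (Fin n) ℂ) (a : ℂ) (v : Fin n → ℂ) :
    (borderedMatrix a (star (U.mulVec (star v))) (U * A * U.conjTranspose)).det =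
      (borderedMatrix a v A).det := by
  have h1 : (borderedMatrix 1 0 U).conjTranspose * borderedMatrix 1 0 U = 1 := by
    have h : ∀ i j, ∑ k, star (U k i) * U k j = (1 : Matrix (Fin n) (Fin n) ℂ) i j := fun i j => by
      rw [← hU]; rfl
    ext i j
    refine Fin.cases ?_ (fun i => ?_) i <;> refine Fin.cases ?_ (fun j => ?_) j
    · simp [Matrix.mul_apply, Fin.sum_univ_succ]
    · simp [Matrix.mul_apply, Fin.sum_univ_succ, (Fin.succ_ne_zero _).symm]
    · simp [Matrix.mul_apply, Fin.sum_univ_succ, Fin.succ_ne_zero]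
    · simpa [Matrix.mul_apply, Fin.sum_univ_succ, Matrix.one_apply] using h i j
  rw [← borderedMatrix_one_zero_mul, Matrix.det_mul, Matrix.det_mul, mul_right_comm,
    mul_comm (Matrix.det _) (Matrix.det (Matrix.conjTranspose _)), ← Matrix.det_mul, h1,
    Matrix.det_one, one_mul]

theorem det_borderedMatrix_single (a : ℂ) (t : ℝ) (A : Matrix (Fin (n + 1)) (Fin (n + 1)) ℂ) :
    (borderedMatrix a (Pi.single 0 (t : ℂ)) A).det =
      a * A.det - (t : ℂ) ^ 2 * (A.submatrix Fin.succ Fin.succ).det := by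
  have h1 : (((borderedMatrix a (Pi.single 0 (t : ℂ)) A).submatrix Fin.succ
      (Fin.succAbove 1)).submatrix Fin.succ Fin.succ) = A.submatrix Fin.succ Fin.succ := by
    ext i j
    simp [Fin.one_succAbove_succ]
  have h2 : ((borderedMatrix a (Pi.single 0 (t : ℂ)) A).submatrix Fin.succ
      (Fin.succAbove 1)).det = t * (A.submatrix Fin.succ Fin.succ).det := by
    rw [Matrix.det_succ_column_zero, Fin.sum_univ_succ, Finset.sum_eq_zero, add_zero]
    · have h3 : borderedMatrix a (Pi.single 0 (t : ℂ)) A 1 0 = t := by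
        change star ((Pi.single 0 (t : ℂ) : Fin (n + 1) → ℂ) 0) = t
        simp
      simp [h1, h3]
    · intro i _
      simp
  rw [Matrix.det_succ_row_zero, Fin.sum_univ_succ, Fin.sum_univ_succ, Finset.sum_eq_zero,
    add_zero, show (Fin.succ 0 : Fin (n + 2)) = 1 from rfl, h2]
  · simp only [Fin.succAbove_zero, borderedMatrix_submatrix_succ]
    have h3 : borderedMatrix a (Pi.single 0 (t : ℂ)) A 0 1 = t := by
      change (Pi.single 0 (t : ℂ) : Fin (n + 1) → ℂ) 0 = t
      simp
    simp [h3]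
    ring
  · intro j _
    have h3 : borderedMatrix a (Pi.single 0 (t : ℂ)) A 0 j.succ.succ = 0 := by simp
    rw [h3]
    ring

/-- Take t = ‖v‖ and complete v/‖v‖ to an orthonormal basis, whose vectors are the columns of U; for
v = 0 the identity works. -/
theorem exists_unitary_mulVec_single (v : Fin (n + 1) → ℂ) :
    ∃ (U : Matrix (Fin (n + 1)) (Fin (n + 1)) ℂ) (t : ℝ), U.conjTranspose * U = 1 ∧
      U.mulVec (Pi.single 0 (t : ℂ)) = v ∧ (t : ℂ) ^ 2 = ∑ i, (Complex.normSq (v i) : ℂ) := by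
  let w : EuclideanSpace ℂ (Fin (n + 1)) := WithLp.toLp 2 v
  have hw : (‖w‖ : ℂ) ^ 2 = ∑ i, (Complex.normSq (v i) : ℂ) := by
    rw [← Complex.ofReal_pow, EuclideanSpace.norm_sq_eq, Complex.ofReal_sum]
    simp [w, Complex.normSq_eq_norm_sq]
  by_cases h0 : w = 0
  · refine ⟨1, ‖w‖, by simp, ?_, hw⟩
    have : v = 0 := by simpa [w] using h0
    simp [h0, this]
  · have hn : ‖w‖ ≠ 0 := norm_ne_zero_iff.2 h0
    have hv : Orthonormal ℂ (({0} : Set (Fin (n + 1))).domRestrict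
        fun _ => ((‖w‖ : ℂ)⁻¹) • w) := by
      constructor
      · intro i
        simp [norm_smul, hn]
      · intro i j hij
        exact absurd (Subsingleton.elim i j) hij
    obtain ⟨b, hb⟩ := hv.exists_orthonormalBasis_extension_of_card_eq (by simp)
    have hb0 := hb 0 rfl
    refine ⟨(EuclideanSpace.basisFun (Fin (n + 1)) ℂ).toBasis.toMatrix b, ‖w‖, ?_, ?_, hw⟩
    · exact Matrix.mem_unitaryGroup_iff'.1
        ((EuclideanSpace.basisFun (Fin (n + 1)) ℂ).toMatrix_orthonormalBasis_mem_unitary b)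
    · ext i
      have hn' : (‖w‖ : ℂ) ≠ 0 := Complex.ofReal_ne_zero.2 hn
      rw [Matrix.mulVec_single]
      simpa [Module.Basis.toMatrix_apply, hb0, w] using
        (by field_simp : (‖w‖ : ℂ)⁻¹ * v i * ‖w‖ = v i)

end Bordered

-- The recursion for the joint moments.

section Recursion

variable {n : ℕ}

theorem hasAllMoments_hermitianOfCoords (i j : Fin n) :
    HasAllMoments (fun x => hermitianOfCoords x i j) (gueCoords n) := by
  have h : ∀ k l : Fin n, HasAllMoments (fun x : Fin n → Fin n → ℝ => (x k l : ℂ))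
      (gueCoords n) := fun k l =>
    ((hasAllMoments_gaussianReal _).comp (measurePreserving_eval _ l)).comp
      (measurePreserving_eval (fun i : Fin n => Measure.pi fun j : Fin n =>
        gaussianReal 0 (if i = j then 1 else 1 / 2)) k)
  simp only [hermitianOfCoords, Matrix.of_apply, sub_eq_add_neg]
  split_ifs
  · exact h i i
  · exact (h i j).add ((h j i).mul (.const _))
  · exact (h j i).add ((h i j).mul (.const _)).neg

theorem measurable_matrix_apply (i j : Fin n) :
    Measurable fun A : Matrix (Fin n) (Fin n) ℂ => A i j :=
  (measurable_pi_apply j).comp (measurable_pi_apply i)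

theorem hasAllMoments_gue (i j : Fin n) : HasAllMoments (fun A => A i j) (gue n) := fun p hp => by
  rw [← (measurePreserving_hermitianOfCoords n).map_eq, memLp_map_measure_iff
    (measurable_matrix_apply i j).aestronglyMeasurable
    measurable_hermitianOfCoords.aemeasurable]
  exact hasAllMoments_hermitianOfCoords i j p hp

theorem hasAllMoments_gue_det : HasAllMoments Matrix.det (gue n) :=
  HasAllMoments.det hasAllMoments_gue

theorem hasAllMoments_gue_minor :
    HasAllMoments (fun A => (A.submatrix Fin.succ Fin.succ).det) (gue (n + 1)) :=
  HasAllMoments.det fun i j => hasAllMoments_gue i.succ j.succ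

/-- The joint moments of the determinants of a `GUE` matrix and of its lower right principal
minor. -/
noncomputable def minorMoment : ℕ → ℕ → ℕ → ℂ
  -- Order 0 has no minor; the empty determinant 1 is the value that fits the product formulas.
  | 0, _, _ => 1
  | n + 1, p, q =>
    ∫ A, A.det ^ p * (A.submatrix Fin.succ Fin.succ).det ^ q ∂(gue (n + 1))

theorem integral_det_pow (n k : ℕ) : ∫ A, A.det ^ k ∂(gue n) = minorMoment n k 0 := by
  cases n with
  | zero => simp [minorMoment]
  | succ n => simp [minorMoment]

theorem measurable_det_borderedMatrix_pow_mul (a : ℂ) (v : Fin n → ℂ) (p q : ℕ) :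
    Measurable fun A : Matrix (Fin n) (Fin n) ℂ =>
      (borderedMatrix a v A).det ^ p * A.det ^ q := by
  have h1 := measurable_matrix_apply (n := n)
  have h2 : ∀ i j, Measurable fun A => borderedMatrix a v A i j := by
    intro i j
    refine Fin.cases ?_ (fun i => ?_) i <;> refine Fin.cases ?_ (fun j => ?_) j <;>
      simp only [borderedMatrix_zero_zero, borderedMatrix_zero_succ, borderedMatrix_succ_zero,
        borderedMatrix_succ_succ] <;> fun_prop
  simp only [Matrix.det_apply']
  fun_prop

theorem integral_borderedMatrix (a : ℂ) (v : Fin (n + 1) → ℂ) (p q : ℕ) :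
    ∫ A, (borderedMatrix a v A).det ^ p * A.det ^ q ∂(gue (n + 1)) =
      ∑ s ∈ Finset.range (p + 1), (p.choose s : ℂ) * a ^ (p - s) * (-1) ^ s *
        (∑ i, (Complex.normSq (v i) : ℂ)) ^ s * minorMoment (n + 1) (q + (p - s)) s := by
  -- Conjugation by 1 ⊕ U acts on the conjugate of the border row, hence `star v`.
  obtain ⟨U, t, hU, hUv, ht⟩ := exists_unitary_mulVec_single (star v)
  have ht' : (t : ℂ) ^ 2 = ∑ i, (Complex.normSq (v i) : ℂ) := by simpa using ht
  have hstar : star (Pi.single 0 (t : ℂ) : Fin (n + 1) → ℂ) = Pi.single 0 (t : ℂ) := by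
    ext i
    by_cases hi : i = 0
    · subst hi; simp
    · simp [hi]
  have hv : v = star (U.mulVec (star (Pi.single 0 (t : ℂ)))) := by rw [hstar, hUv, star_star]
  have hmeas := measurable_det_borderedMatrix_pow_mul a v p q
  have hmp := measurePreserving_gue_conj hU
  have hdet : ∀ A, (U * A * U.conjTranspose).det = A.det := fun A => by
    rw [Matrix.det_mul, Matrix.det_mul, mul_right_comm, mul_comm U.det, ← Matrix.det_mul, hU,
      Matrix.det_one, one_mul]
  calc _ = ∫ A, (borderedMatrix a v (U * A * U.conjTranspose)).det ^ p *
        (U * A * U.conjTranspose).det ^ q ∂(gue (n + 1)) := by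
        conv_lhs => rw [← hmp.map_eq]
        exact integral_map hmp.aemeasurable hmeas.aestronglyMeasurable
    _ = ∫ A, ∑ s ∈ Finset.range (p + 1), (p.choose s : ℂ) * a ^ (p - s) * (-1) ^ s *
        (∑ i, (Complex.normSq (v i) : ℂ)) ^ s * (A.det ^ (q + (p - s)) *
          (A.submatrix Fin.succ Fin.succ).det ^ s) ∂(gue (n + 1)) := by
        refine integral_congr_ae (.of_forall fun A => ?_)
        simp only
        rw [hdet]
        conv_lhs => rw [hv, det_borderedMatrix_conj hU, det_borderedMatrix_single, sub_eq_neg_add,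
          add_pow, Finset.sum_mul]
        refine Finset.sum_congr rfl fun s _ => ?_
        rw [ht', neg_pow, mul_pow, mul_pow, pow_add]
        ring
    _ = _ := by
        rw [integral_finsetSum _ fun s _ => (((hasAllMoments_gue_det.pow _).mul
          (hasAllMoments_gue_minor.pow _)).integrable.const_mul _)]
        simp_rw [integral_const_mul]
        rfl

/-- Conjugating the minor by a unitary matrix reduces the border to a multiple of a basis vector,
and the determinant expands along it. -/
theorem minorMoment_add_two (n p q : ℕ) :
    minorMoment (n + 2) p q = ∑ s ∈ Finset.range (p + 1), (p.choose s : ℂ) *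
      gaussianMoment ℂ (p - s) * (-1) ^ s * risingFactorial ((n + 1 : ℕ) : ℂ) s *
        minorMoment (n + 1) (q + (p - s)) s := by
  have hmp := (measurePreserving_hermitianOfCoords (n + 2)).comp
    (measurePreserving_borderCoords (n + 1))
  have hall : HasAllMoments (fun A => A.det ^ p * (A.submatrix Fin.succ Fin.succ).det ^ q)
      (gue (n + 2)) := (hasAllMoments_gue_det.pow p).mul (hasAllMoments_gue_minor.pow q)
  have hint := (hall.comp hmp).integrable
  have hcoords := measurePreserving_hermitianOfCoords (n + 1)
  rw [minorMoment]
  conv_lhs => rw [← hmp.map_eq]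
  rw [integral_map hmp.aemeasurable (by rw [hmp.map_eq]; exact hall.integrable.1),
    integral_prod _ hint]
  simp only [Function.comp_apply, hermitianOfCoords_borderCoords, borderedMatrix_submatrix_succ]
  -- By Fubini the block is integrated first with the border b fixed, so the rotation U may depend
  -- on b and no measurable choice of it is needed.
  have hinner : ∀ b : ℝ × ((Fin (n + 1) → ℝ) × (Fin (n + 1) → ℝ)),
      ∫ y, (borderedMatrix (b.1 : ℂ) (fun j => (b.2.1 j : ℂ) + (b.2.2 j : ℂ) * Complex.I)
        (hermitianOfCoords y)).det ^ p * (hermitianOfCoords y).det ^ q ∂(gueCoords (n + 1)) =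
      ∑ s ∈ Finset.range (p + 1), ((p.choose s : ℂ) * (-1) ^ s *
        minorMoment (n + 1) (q + (p - s)) s) * ((b.1 : ℂ) ^ (p - s) *
        (∑ i, (b.2.1 i : ℂ) ^ 2 + ∑ i, (b.2.2 i : ℂ) ^ 2) ^ s) := by
    intro b
    have h := integral_borderedMatrix (b.1 : ℂ)
      (fun j => (b.2.1 j : ℂ) + (b.2.2 j : ℂ) * Complex.I) p q
    rw [← hcoords.map_eq, integral_map hcoords.aemeasurable
      (measurable_det_borderedMatrix_pow_mul _ _ p q).aestronglyMeasurable] at h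
    refine h.trans (Finset.sum_congr rfl fun s _ => ?_)
    simp only [Complex.normSq_add_mul_I, Complex.ofReal_add, Complex.ofReal_pow,
      Finset.sum_add_distrib]
    ring
  simp_rw [hinner]
  rw [integral_finsetSum]
  · refine Finset.sum_congr rfl fun s _ => ?_
    rw [integral_const_mul, integral_prod_mul (fun x : ℝ => (x : ℂ) ^ (p - s))
      (fun z : (Fin (n + 1) → ℝ) × (Fin (n + 1) → ℝ) =>
        (∑ i, (z.1 i : ℂ) ^ 2 + ∑ i, (z.2 i : ℂ) ^ 2) ^ s),
      integral_ofReal_pow_gaussianReal_one, integral_sum_sq_add_sum_sq_pow]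
    ring
  · intro s _
    refine Integrable.const_mul (Integrable.mul_prod (f := fun x : ℝ => (x : ℂ) ^ (p - s))
      (g := fun z : (Fin (n + 1) → ℝ) × (Fin (n + 1) → ℝ) =>
        (∑ i, (z.1 i : ℂ) ^ 2 + ∑ i, (z.2 i : ℂ) ^ 2) ^ s)
      ((hasAllMoments_gaussianReal 1).pow _).integrable ?_) _
    exact ((((hasAllMoments_sum_sq _ _).comp measurePreserving_fst).add
      ((hasAllMoments_sum_sq _ _).comp measurePreserving_snd)).pow s).integrable

theorem minorMoment_one (p q : ℕ) : minorMoment 1 p q = gaussianMoment ℂ p := by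
  have hmp := measurePreserving_hermitianOfCoords 1
  have hall : HasAllMoments (fun A => A.det ^ p) (gue 1) := hasAllMoments_gue_det.pow p
  have hev := (measurePreserving_eval (fun j : Fin 1 =>
    gaussianReal 0 (if (0 : Fin 1) = j then 1 else 1 / 2)) 0).comp
    (measurePreserving_eval (fun i : Fin 1 => Measure.pi fun j : Fin 1 =>
        gaussianReal 0 (if i = j then 1 else 1 / 2)) 0)
  simp only [if_true] at hev
  rw [← integral_ofReal_pow_gaussianReal_one]
  conv_rhs => rw [← hev.map_eq]
  rw [integral_map hev.aemeasurable (by fun_prop)]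
  simp only [minorMoment, Matrix.det_fin_zero, one_pow, mul_one]
  conv_lhs => rw [← hmp.map_eq]
  rw [integral_map hmp.aemeasurable (by rw [hmp.map_eq]; exact hall.integrable.1)]
  simp [hermitianOfCoords, gueCoords]

theorem isMinorMoment_minorMoment : IsMinorMoment minorMoment :=
  ⟨minorMoment_one, minorMoment_add_two⟩

end Recursion

-- Moments of the determinant.

theorem corollary3 {Ω : Type*} [MeasurableSpace Ω] (P : Measure Ω) [IsProbabilityMeasure P]
    (n k : ℕ) (M : Ω → Matrix (Fin n) (Fin n) ℂ) (hM : HasLaw M (gue n) P) :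
    Integrable (fun ω => (M ω ^ k).det) P ∧
    (Even k → ∫ ω, (M ω ^ k).det ∂P =
      ∏ i ∈ Finset.Icc 1 n, ∏ j ∈ Finset.Icc 1 (k / 2),
        (2 * ((i / 2 : ℕ) : ℂ) + 2 * (j : ℂ) - 1)) ∧
    (Even n → ∫ ω, (M ω ^ k).det ∂P =
      (-1 : ℂ) ^ (n * k / 2) * ∏ i ∈ Finset.Icc 1 k, ∏ j ∈ Finset.Icc 1 (n / 2),
        (2 * ((i / 2 : ℕ) : ℂ) + 2 * (j : ℂ) - 1)) ∧
    (Odd n → Odd k → ∫ ω, (M ω ^ k).det ∂P = 0) := by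
  have hint : Integrable (fun A => A.det ^ k) (P.map M) := by
    rw [hM.map_eq]; exact (hasAllMoments_gue_det.pow k).integrable
  have heq : ∫ ω, (M ω).det ^ k ∂P = minorMoment n k 0 := by
    rw [← integral_det_pow, ← hM.map_eq, integral_map hM.aemeasurable hint.1]
  have hF := isMinorMoment_minorMoment
  simp only [Matrix.det_pow, heq]
  refine ⟨hint.comp_aemeasurable hM.aemeasurable, ?_, ?_, fun hn hk => hF.odd_order_odd_degree hn hk⟩
  · intro hk
    obtain ⟨c, rfl⟩ := hk.two_dvd
    rw [Nat.mul_div_cancel_left c two_pos]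
    exact hF.even_degree (fun _ _ => rfl) n c
  · intro hn
    obtain ⟨N, rfl⟩ := hn.two_dvd
    rw [mul_assoc, Nat.mul_div_cancel_left _ two_pos, Nat.mul_div_cancel_left _ two_pos]
    exact hF.even_order (fun _ _ => rfl) N k
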